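/- Let $k$ be a field. Let $G$ be a directed graph whose vertex set is a disjoint union of finite sets (levels) $V_0,V_1,V_2,\ldots$, with a finite number $c_{ji}\ge 0$ of edges from each $i\in V_n$ to each $j\in V_{n+1}$ and no other edges. A labelling of $G$ assigns to every vertex $i$ an integer $d(i)\ge 0$ such that $d(j)=\sum_{i\in V_n}c_{ji}\,d(i)$ for all $n\ge 0$ and $j\in V_{n+1}$; the graph with such a labelling is a Bratteli diagram. A $k$-algebra $A$ is an ultramatricial $k$-algebra formed from this Bratteli diagram if it is isomorphic to the direct limit of a sequence of unital $k$-algebra homomorphisms $$\theta_n:\prod_{i\in V_n}M_{d(i)}(k)\longrightarrow\prod_{j\in V_{n+1}}M_{d(j)}(k)\qquad(n\ge 0)$$ such that for each $j\in V_{n+1}$ the $j$-th component of $\theta_n$ sends $(x_i)_{i\in V_n}$, up to conjugation by a fixed invertible matrix, to the block-diagonal matrix having $c_{ji}$ diagonal blocks equal to $x_i$ for every $i\in V_n$. (Here $M_0(k)=0$.) Let $d$ and $d'$ be two labellings of the same graph $G$. Assume that $G$ has no infinite directed path all of whose vertices have $d$-label $0$, and none all of whose vertices have $d'$-label $0$ (for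 instance, that all labels are positive). If $A$ and $B$ are ultramatricial $k$-algebras formed from the Bratteli diagrams $(G,d)$ and $(G,d')$, respectively, then $A$ and $B$ are Morita equivalent over $k$, i.e. there is a $k$-linear equivalence between their module categories. -/

import Mathlib

/-- The unlabelled directed graph underlying a Bratteli diagram: finite levels `V 0, V 1, …` of
vertices, and `mult i j` edges from a vertex `i` of level `n` to a vertex `j` of level `n + 1`. -/
structure BratteliGraph where
  V : ℕ → Type*
  [fintypeV : ∀ n, Fintype (V n)]
  [decEqV : ∀ n, DecidableEq (V n)]
  mult : ∀ {n : ℕ}, V n → V (n + 1) → ℕ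

attribute [instance] BratteliGraph.fintypeV BratteliGraph.decEqV

/-- A labelling turning the graph `G` into a Bratteli diagram (with unital connecting maps): the
label of `i` is the size of the matrix algebra at `i`. The label `0` (an empty matrix block) is
allowed. -/
structure BratteliLabelling (G : BratteliGraph) where
  size : ∀ {n : ℕ}, G.V n → ℕ
  size_succ : ∀ {n : ℕ} (j : G.V (n + 1)), size j = ∑ i : G.V n, G.mult i j * size i

/-- No infinite directed path of the graph has all its vertices labelled `0`. In particular
this holds when all labels are positive. -/
def BratteliLabelling.NoZeroPath {G : BratteliGraph} (d : BratteliLabelling G) : Prop :=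
  ∀ (n : ℕ) (p : ∀ m : ℕ, G.V (n + m)),
    (∀ m : ℕ, 0 < G.mult (p m) (p (m + 1))) → ∃ m : ℕ, 0 < d.size (p m)

/-- The `n`-th algebra of the system: the product of the matrix algebras at level `n`. -/
abbrev BratteliLabelling.Stage (k : Type*) {G : BratteliGraph} (d : BratteliLabelling G)
    (n : ℕ) : Type _ :=
  ∀ i : G.V n, Matrix (Fin (d.size i)) (Fin (d.size i)) k

/-- The block-diagonal matrix with `mult i j` diagonal blocks equal to `x i`, for every vertex `i`
of level `n`. -/
def BratteliLabelling.blockCopies {k : Type*} [Field k] {G : BratteliGraph}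
    (d : BratteliLabelling G) {n : ℕ} (j : G.V (n + 1)) (x : d.Stage k n) :
    Matrix (Σ p : (Σ i : G.V n, Fin (G.mult i j)), Fin (d.size p.1))
      (Σ p : (Σ i : G.V n, Fin (G.mult i j)), Fin (d.size p.1)) k :=
  Matrix.blockDiagonal' fun p : (Σ i : G.V n, Fin (G.mult i j)) => x p.1

/-- A sequence of unital `k`-algebra homomorphisms between the finite stages whose component into
the block at `j` is, in a suitable basis, `x ↦ ` the block-diagonal matrix with `mult i j` copies
of `x i` for every `i`. -/
structure BratteliSystem (k : Type*) [Field k] {G : BratteliGraph} (d : BratteliLabelling G) where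
  map : ∀ n : ℕ, d.Stage k n →ₐ[k] d.Stage k (n + 1)
  map_eq : ∀ (n : ℕ) (j : G.V (n + 1)),
    ∃ (e : (Σ p : (Σ i : G.V n, Fin (G.mult i j)), Fin (d.size p.1)) ≃ Fin (d.size j))
      (u : (Matrix (Fin (d.size j)) (Fin (d.size j)) k)ˣ), ∀ x : d.Stage k n,
        map n x j = u.val * Matrix.reindex e e (d.blockCopies j x) * u⁻¹.val

namespace BratteliSystem

variable {k : Type*} [Field k] {G : BratteliGraph} {d : BratteliLabelling G}

/-- The composite homomorphism from stage `n` to stage `m`, for `n ≤ m`. -/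
def trans (S : BratteliSystem k d) (n m : ℕ) (h : n ≤ m) : d.Stage k n →ₐ[k] d.Stage k m :=
  Nat.leRec (motive := fun m _ => d.Stage k n →ₐ[k] d.Stage k m) (AlgHom.id k (d.Stage k n))
    (fun m _ f => (S.map m).comp f) h

theorem trans_self (S : BratteliSystem k d) (n : ℕ) :
    S.trans n n le_rfl = AlgHom.id k (d.Stage k n) := by
  simp [trans]

theorem trans_succ (S : BratteliSystem k d) {n m : ℕ} (h : n ≤ m) :
    S.trans n (m + 1) (Nat.le_succ_of_le h) = (S.map m).comp (S.trans n m h) := by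
  unfold trans
  rw [Nat.leRec_succ]

instance directedSystem (S : BratteliSystem k d) :
    DirectedSystem (d.Stage k) (fun n m h => S.trans n m h) where
  map_self n x := by simp [trans_self]
  map_map {a b c} hcb hba x := by
    induction a, hba using Nat.le_induction with
    | base => simp [trans_self]
    | succ a hba ih =>
      rw [trans_succ S hba, trans_succ S (hcb.trans hba)]
      simp only [AlgHom.comp_apply]
      rw [ih]

/-- The direct limit of the system, as a `k`-algebra. -/
abbrev Limit (S : BratteliSystem k d) : Type _ :=
  DirectLimit (d.Stage k) S.trans

end BratteliSystem

/-- `A` is an ultramatricial `k`-algebra formed from the Bratteli diagram given by the graph `G`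
and the labelling `d`. -/
def IsUltramatricialOf (k : Type*) [Field k] {G : BratteliGraph} (d : BratteliLabelling G)
    (A : Type*) [Ring A] [Algebra k A] : Prop :=
  ∃ S : BratteliSystem k d, Nonempty (A ≃ₐ[k] S.Limit)

/-! Morita equivalence comes from a common linking algebra. At level `n`, the product of the matrix
algebras of size `d(i) + d'(i)` contains the two given stages as its diagonal corners. The
multiplicities depend only on the graph, so both systems extend to one system of linking algebras
(`exists_linkingMap`), and its limit `R` has `A` and `B` as corners `e R e` and `f R f`. It remains
to see that `e` and `f` are full, since a full corner is Morita equivalent to the whole algebra by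
`M ↦ e M`. Fullness of `e` at a single level passes to the limit (`FullCorner.directLimit`), and at
level `n` it means that no vertex has `d = 0 < d'`. Such a vertex always has a predecessor of the
same kind, so if every level had one, König's lemma would give an infinite path of `d`-label `0`
(`NoZeroPath.exists_level`). The argument for `f` is symmetric. -/

open CategoryTheory

/-! ### Morita equivalence of an algebra with its full corners -/

section CornerMorita

open scoped ModuleCat.Algebra

variable {k : Type*} [CommRing k] {A : Type*} [Ring A] [Algebra k A] {R : Type*} [Ring R]
  [Algebra k R]

/-- A realization of the algebra `A` as the corner `e R e` of `R` at the full idempotent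
`e = φ 1`. -/
structure FullCorner (k A R : Type*) [CommRing k] [Ring A] [Algebra k A] [Ring R]
    [Algebra k R] where
  φ : A →ₙₐ[k] R
  injective : Function.Injective φ
  exists_eq (r : R) : ∃ a, φ a = φ 1 * r * φ 1
  ι : Type
  [fintype : Fintype ι]
  left : ι → R
  right : ι → R
  sum_eq_one : ∑ i, left i * φ 1 * right i = 1

namespace FullCorner

attribute [instance] FullCorner.fintype

variable (C : FullCorner k A R)

theorem mul_one_left (a : A) : C.φ 1 * C.φ a = C.φ a := by
  rw [← map_mul, one_mul]

theorem mul_one_right (a : A) : C.φ a * C.φ 1 = C.φ a := by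
  rw [← map_mul, mul_one]

theorem one_mul_one : C.φ 1 * C.φ 1 = C.φ 1 := C.mul_one_left 1

/-! ### Full faithfulness of `M ↦ e M` -/

section Module

variable (M : Type*) [AddCommGroup M] [Module R M]

/-- The additive subgroup `e M` of an `R`-module `M`. -/
def fixed : AddSubgroup M where
  carrier := {x | C.φ 1 • x = x}
  add_mem' {x y} hx hy := by simp_all
  zero_mem' := by simp
  neg_mem' {x} hx := by simp_all

variable {M}

theorem mem_fixed {x : M} : x ∈ C.fixed M ↔ C.φ 1 • x = x := Iff.rfl

theorem smul_mem_fixed (a : A) (x : M) : C.φ a • x ∈ C.fixed M := by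
  rw [mem_fixed, ← mul_smul, mul_one_left]

instance : SMul A (C.fixed M) where
  smul a x := ⟨C.φ a • (x : M), C.smul_mem_fixed a _⟩

@[simp]
theorem coe_smul (a : A) (x : C.fixed M) : ((a • x : C.fixed M) : M) = C.φ a • (x : M) := rfl

instance : Module A (C.fixed M) where
  one_smul x := Subtype.ext x.2
  mul_smul a b x := Subtype.ext (by simp [mul_smul])
  smul_zero a := Subtype.ext (by simp)
  smul_add a x y := Subtype.ext (by simp)
  add_smul a b x := Subtype.ext (by simp [add_smul])
  zero_smul x := Subtype.ext (by simp)

/-- An `R`-linear map `M → N` restricts to an `A`-linear map `e M → e N`. -/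
def mapFixed {N : Type*} [AddCommGroup N] [Module R N] (f : M →ₗ[R] N) :
    C.fixed M →ₗ[A] C.fixed N where
  toFun x := ⟨f x, by rw [mem_fixed, ← map_smul, C.mem_fixed.1 x.2]⟩
  map_add' x y := Subtype.ext (by simp)
  map_smul' a x := Subtype.ext (by simp)

theorem sum_smul_eq (x : M) : ∑ i, C.left i • C.φ 1 • C.right i • x = x := by
  simp_rw [← mul_smul, ← mul_assoc, ← Finset.sum_smul, C.sum_eq_one, one_smul]

/-- The element `e y` of `e M`. -/
def toFixed (y : M) : C.fixed M := ⟨C.φ 1 • y, C.smul_mem_fixed 1 y⟩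

@[simp]
theorem coe_toFixed (y : M) : (C.toFixed y : M) = C.φ 1 • y := rfl

theorem smul_smul_eq {r : R} {a : A} (ha : C.φ a = C.φ 1 * r * C.φ 1) (x : C.fixed M) :
    C.φ 1 • r • (x : M) = C.φ a • (x : M) := by
  rw [ha, mul_smul, mul_smul, C.mem_fixed.1 x.2]

variable {N : Type*} [AddCommGroup N] [Module R N]

/-- `A`-linearity controls only the action of `e R e`; on `e M`, however, `e r` acts as `e r e`, an
element of the corner. -/
theorem map_toFixed (g : C.fixed M →ₗ[A] C.fixed N) (r : R) (x : C.fixed M) :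
    (g (C.toFixed (r • (x : M))) : N) = C.φ 1 • r • (g x : N) := by
  obtain ⟨a, ha⟩ := C.exists_eq r
  have h1 : C.toFixed (r • (x : M)) = a • x := Subtype.ext (C.smul_smul_eq ha x)
  rw [h1, map_smul, coe_smul, C.smul_smul_eq ha]

/-- Every `A`-linear map `e M → e N` is the restriction of an `R`-linear map `M → N`. -/
def extend (g : C.fixed M →ₗ[A] C.fixed N) : M →ₗ[R] N where
  toFun x := ∑ i, C.left i • (g (C.toFixed (C.right i • x)) : N)
  map_add' x y := by
    rw [← Finset.sum_add_distrib]
    refine Finset.sum_congr rfl fun i _ => ?_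
    have : C.toFixed (C.right i • (x + y)) =
        C.toFixed (C.right i • x) + C.toFixed (C.right i • y) := Subtype.ext (by simp)
    rw [this, map_add, AddSubgroup.coe_add, smul_add]
  map_smul' r x := by
    -- Inserting `1 = ∑ left j * e * right j` to the right of `r` turns the coefficient into `e *
    -- right i * r * left j * e`, which lies in the corner and so commutes with `g`.
    have key (i : C.ι) : (g (C.toFixed (C.right i • r • x)) : N) =
        ∑ j, C.φ 1 • C.right i • r • C.left j • (g (C.toFixed (C.right j • x)) : N) := by
      have : C.toFixed (C.right i • r • x) =
          ∑ j, C.toFixed ((C.right i * r * C.left j) • (C.toFixed (C.right j • x) : M)) := by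
        refine Subtype.ext ?_
        conv_lhs => rw [← C.sum_smul_eq x]
        simp [Finset.smul_sum, mul_smul]
      rw [this, map_sum, AddSubgroup.val_finsetSum]
      refine Finset.sum_congr rfl fun j _ => ?_
      rw [map_toFixed, mul_smul, mul_smul]
    simp_rw [key, Finset.smul_sum, RingHom.id_apply]
    rw [Finset.sum_comm]
    exact Finset.sum_congr rfl fun j _ => C.sum_smul_eq _

theorem mapFixed_extend (g : C.fixed M →ₗ[A] C.fixed N) : C.mapFixed (C.extend g) = g := by
  refine LinearMap.ext fun x => Subtype.ext ?_
  change ∑ i, C.left i • (g (C.toFixed (C.right i • (x : M))) : N) = g x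
  simp_rw [map_toFixed]
  exact C.sum_smul_eq _

theorem mapFixed_injective {f g : M →ₗ[R] N} (h : C.mapFixed f = C.mapFixed g) : f = g := by
  have h' (y : M) : f (C.φ 1 • y) = g (C.φ 1 • y) :=
    congrArg Subtype.val (LinearMap.congr_fun h (C.toFixed y))
  ext x
  rw [← C.sum_smul_eq x, map_sum, map_sum]
  refine Finset.sum_congr rfl fun i _ => ?_
  rw [map_smul f, map_smul g, h']

end Module

/-! ### Essential surjectivity: the induced module -/

section Induced

/-- The inverse of the isomorphism `A ≃ e R e`, composed with `r ↦ e r e`. -/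
noncomputable def compress (r : R) : A := (C.exists_eq r).choose

theorem φ_compress (r : R) : C.φ (C.compress r) = C.φ 1 * r * C.φ 1 := (C.exists_eq r).choose_spec

/-- The matrix coefficients of the action of `R` on `R e`, with respect to the generators
`left i * e`. -/
noncomputable def coeff (i j : C.ι) (r : R) : A := C.compress (C.right i * r * C.left j)

theorem φ_coeff (i j : C.ι) (r : R) :
    C.φ (C.coeff i j r) = C.φ 1 * C.right i * r * C.left j * C.φ 1 := by
  simp only [coeff, φ_compress, mul_assoc]

theorem coeff_add (i j : C.ι) (r s : R) : C.coeff i j (r + s) = C.coeff i j r + C.coeff i j s :=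
  C.injective (by simp only [map_add, φ_coeff, mul_add, add_mul])

theorem coeff_zero (i j : C.ι) : C.coeff i j 0 = 0 :=
  C.injective (by simp [φ_coeff])

theorem mul_sum_mul (r s : R) :
    ∑ j, r * C.left j * C.φ 1 * (C.φ 1 * C.right j * s) = r * s := by
  have : ∀ j, r * C.left j * C.φ 1 * (C.φ 1 * C.right j * s) =
      r * (C.left j * C.φ 1 * C.right j) * s := fun j => by
    conv_rhs => rw [← C.one_mul_one]
    simp only [mul_assoc]
  simp_rw [this]
  rw [← Finset.sum_mul, ← Finset.mul_sum, C.sum_eq_one, mul_one]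

/-- Thus `r ↦ (coeff i j r)` is multiplicative into matrices over `A`. The matrix of `1` need not be
the identity, only an idempotent, and `Induced` is its image. -/
theorem coeff_mul (i l : C.ι) (r s : R) :
    C.coeff i l (r * s) = ∑ j, C.coeff i j r * C.coeff j l s := by
  apply C.injective
  have := C.mul_sum_mul (C.φ 1 * C.right i * r) (s * C.left l * C.φ 1)
  simp only [map_sum, map_mul, φ_coeff]
  simp only [mul_assoc] at this ⊢
  exact this.symm

variable (N : Type*) [AddCommGroup N] [Module A N]

/-- The `R`-module `R e ⊗ N` induced by an `A`-module `N`, realized as a direct summand of a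
power of `N`. -/
def Induced : AddSubgroup (C.ι → N) where
  carrier := {v | ∀ i, ∑ j, C.coeff i j 1 • v j = v i}
  add_mem' {v w} hv hw i := by
    simp only [Pi.add_apply, smul_add, Finset.sum_add_distrib, hv i, hw i]
  zero_mem' := by simp
  neg_mem' {v} hv i := by simp only [Pi.neg_apply, smul_neg, Finset.sum_neg_distrib, hv i]

variable {N}

theorem sum_coeff_mul_smul (r s : R) (v : C.ι → N) (i : C.ι) :
    ∑ j, C.coeff i j r • ∑ l, C.coeff j l s • v l = ∑ l, C.coeff i l (r * s) • v l := by
  simp_rw [coeff_mul, Finset.smul_sum, Finset.sum_smul, mul_smul]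
  exact Finset.sum_comm

noncomputable instance : SMul R (C.Induced N) where
  smul r v := ⟨fun i => ∑ j, C.coeff i j r • v.1 j, fun i => by
    rw [sum_coeff_mul_smul, one_mul]⟩

theorem induced_smul_apply (r : R) (v : C.Induced N) (i : C.ι) :
    (r • v).1 i = ∑ j, C.coeff i j r • v.1 j := rfl

noncomputable instance : Module R (C.Induced N) where
  one_smul v := Subtype.ext (funext v.2)
  mul_smul r s v := Subtype.ext (funext fun i => (C.sum_coeff_mul_smul r s v.1 i).symm)
  smul_zero r := Subtype.ext (funext fun i => by simp [induced_smul_apply])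
  smul_add r v w := Subtype.ext (funext fun i => by
    simp [induced_smul_apply, Finset.sum_add_distrib])
  add_smul r s v := Subtype.ext (funext fun i => by
    simp [induced_smul_apply, coeff_add, add_smul, Finset.sum_add_distrib])
  zero_smul v := Subtype.ext (funext fun i => by simp [induced_smul_apply, coeff_zero])

theorem sum_compress_mul (i : C.ι) (r : R) :
    ∑ j, C.coeff i j r * C.compress (C.right j) = C.compress (C.right i * r) := by
  apply C.injective
  have := C.mul_sum_mul (C.φ 1 * C.right i * r) (C.φ 1)
  simp only [map_sum, map_mul, φ_coeff, φ_compress]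
  simp only [mul_assoc] at this ⊢
  exact this

theorem sum_compress_left_mul : ∑ j, C.compress (C.left j) * C.compress (C.right j) = 1 := by
  apply C.injective
  have := C.mul_sum_mul (C.φ 1) (C.φ 1)
  simp only [map_sum, map_mul, φ_compress]
  simp only [mul_assoc] at this ⊢
  rw [this, one_mul_one]

/-- The matrix of `e` is a column times a row, so `e` acts on the induced module by factoring
through `N`; this identifies the corner with `N`. -/
theorem coeff_one_eq (i j : C.ι) :
    C.coeff i j (C.φ 1) = C.compress (C.right i) * C.compress (C.left j) := by
  apply C.injective
  simp only [map_mul, φ_coeff, φ_compress, mul_assoc]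
  rw [← mul_assoc (C.φ 1) (C.φ 1), one_mul_one]

theorem compress_right_mul_φ (i : C.ι) (a : A) :
    C.compress (C.right i * C.φ a) = C.compress (C.right i) * a := by
  apply C.injective
  simp only [map_mul, φ_compress, mul_assoc, mul_one_left, mul_one_right]

/-- The corner `e (R e ⊗ N)` of the induced module is `N`. -/
noncomputable def fixedInducedEquiv : N ≃ₗ[A] C.fixed (C.Induced N) where
  toFun n := ⟨⟨fun i => C.compress (C.right i) • n, fun i => by
      simp_rw [← mul_smul, ← Finset.sum_smul]
      rw [sum_compress_mul, mul_one]⟩, Subtype.ext (funext fun i => by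
        rw [induced_smul_apply]
        simp_rw [← mul_smul, ← Finset.sum_smul]
        rw [sum_compress_mul, compress_right_mul_φ, mul_one])⟩
  map_add' m n := Subtype.ext (Subtype.ext (funext fun i => smul_add _ _ _))
  map_smul' a n := Subtype.ext (Subtype.ext (funext fun i => by
    rw [RingHom.id_apply, coe_smul, induced_smul_apply]
    simp_rw [← mul_smul, ← Finset.sum_smul]
    rw [sum_compress_mul, compress_right_mul_φ]))
  invFun v := ∑ j, C.compress (C.left j) • v.1.1 j
  left_inv n := by
    simp_rw [← mul_smul, ← Finset.sum_smul]
    rw [sum_compress_left_mul, one_smul]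
  right_inv v := Subtype.ext (Subtype.ext (funext fun i => by
    have h := congrFun (congrArg Subtype.val (C.mem_fixed.1 v.2)) i
    rw [induced_smul_apply] at h
    simp_rw [coeff_one_eq, mul_smul, ← Finset.smul_sum] at h
    exact h))

end Induced

universe w

/-- The functor `M ↦ e M` from `R`-modules to `A`-modules. -/
def functor : ModuleCat.{w} R ⥤ ModuleCat.{w} A where
  obj M := ModuleCat.of A (C.fixed M)
  map f := ModuleCat.ofHom (C.mapFixed f.hom)

instance : C.functor.Faithful where
  map_injective h := ModuleCat.hom_ext (C.mapFixed_injective (ModuleCat.hom_ext_iff.1 h))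

instance : C.functor.Full where
  map_surjective g := ⟨ModuleCat.ofHom (C.extend g.hom),
    ModuleCat.hom_ext (C.mapFixed_extend g.hom)⟩

instance : C.functor.EssSurj where
  mem_essImage N := ⟨ModuleCat.of R (C.Induced N), ⟨C.fixedInducedEquiv.symm.toModuleIso⟩⟩

instance : C.functor.IsEquivalence where

instance : C.functor.Linear k where
  map_smul {M N} f c := by
    refine ModuleCat.hom_ext (LinearMap.ext fun x => Subtype.ext ?_)
    -- On the corner, `c` acts through `φ (c • 1) = c • e`, which agrees with `c` on vectors fixed
    -- by `e`.
    change algebraMap k R c • f.hom x.1 = C.φ (algebraMap k A c) • f.hom x.1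
    rw [← C.mem_fixed.1 x.2, map_smul, ← mul_smul, ← mul_smul, Algebra.algebraMap_eq_smul_one,
      Algebra.algebraMap_eq_smul_one, map_smul]
    simp [one_mul_one]

end FullCorner

/-- Two full corners of the same algebra are Morita equivalent. -/
theorem isMoritaEquivalent_of_fullCorner {B : Type*} [Ring B] [Algebra k B]
    (C : FullCorner k A R) (D : FullCorner k B R) : IsMoritaEquivalent k A B where
  cond := ⟨{
    eqv := C.functor.asEquivalence.symm.trans D.functor.asEquivalence
    linear :=
      haveI : C.functor.asEquivalence.functor.Linear k := inferInstanceAs (C.functor.Linear k)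
      haveI : C.functor.asEquivalence.inverse.Linear k :=
        C.functor.asEquivalence.inverseLinear k
      haveI : D.functor.asEquivalence.functor.Linear k := inferInstanceAs (D.functor.Linear k)
      Functor.instLinearComp C.functor.asEquivalence.inverse D.functor.asEquivalence.functor }⟩

end CornerMorita

/-! ### Directed systems from sequences of homomorphisms -/

section SequentialLimit

/-- The composite `F n → F m`, for `n ≤ m`, of a sequence of algebra homomorphisms. -/
def AlgHom.seqTrans {k : Type*} [CommRing k] {F : ℕ → Type*} [∀ n, Ring (F n)]
    [∀ n, Algebra k (F n)] (f : ∀ n, F n →ₐ[k] F (n + 1)) (n m : ℕ) (h : n ≤ m) : F n →ₐ[k] F m :=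
  Nat.leRec (motive := fun m _ => F n →ₐ[k] F m) (AlgHom.id k (F n))
    (fun m _ g => (f m).comp g) h

variable {k : Type*} [CommRing k] {F : ℕ → Type*} [∀ n, Ring (F n)] [∀ n, Algebra k (F n)]

theorem AlgHom.seqTrans_self (f : ∀ n, F n →ₐ[k] F (n + 1)) (n : ℕ) :
    AlgHom.seqTrans f n n le_rfl = AlgHom.id k (F n) := by
  simp [seqTrans]

theorem AlgHom.seqTrans_succ (f : ∀ n, F n →ₐ[k] F (n + 1)) {n m : ℕ} (h : n ≤ m) :
    AlgHom.seqTrans f n (m + 1) (Nat.le_succ_of_le h) = (f m).comp (AlgHom.seqTrans f n m h) := by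
  unfold seqTrans
  rw [Nat.leRec_succ]

instance AlgHom.directedSystem_seqTrans (f : ∀ n, F n →ₐ[k] F (n + 1)) :
    DirectedSystem F (fun n m h => AlgHom.seqTrans f n m h) where
  map_self n x := by simp [seqTrans_self]
  map_map {a b c} hcb hba x := by
    induction a, hba using Nat.le_induction with
    | base => simp [seqTrans_self]
    | succ a hba ih =>
      rw [seqTrans_succ f hba, seqTrans_succ f (hcb.trans hba), AlgHom.comp_apply, ih,
        AlgHom.comp_apply]

end SequentialLimit

/-! ### Full corners in direct limits -/

section LimitCorner

variable {k : Type*} [CommRing k] {F T : ℕ → Type*} [∀ n, Ring (F n)] [∀ n, Algebra k (F n)]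
  [∀ n, Ring (T n)] [∀ n, Algebra k (T n)]
  (f : ∀ n m (_ : n ≤ m), F n →ₐ[k] F m) [DirectedSystem F (f · · ·)]
  (t : ∀ n m (_ : n ≤ m), T n →ₐ[k] T m) [DirectedSystem T (t · · ·)]

/-- A direct limit of corners, one of which is full, is a full corner. -/
noncomputable def FullCorner.directLimit (φ : ∀ n, F n →ₙₐ[k] T n)
    (compat : ∀ n m h x, φ m (f n m h x) = t n m h (φ n x))
    (inj : ∀ n, Function.Injective (φ n))
    (exists_eq : ∀ n y, ∃ x, φ n x = φ n 1 * y * φ n 1)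
    (N : ℕ) {I : Type*} [Fintype I] (l r : I → T N) (sum_eq : ∑ i, l i * φ N 1 * r i = 1) :
    FullCorner k (DirectLimit F f) (DirectLimit T t) :=
  have compat' : ∀ n m h x, ((DirectLimit.NonUnitalAlgebra.of T t m).comp (φ m)) (f n m h x) =
      ((DirectLimit.NonUnitalAlgebra.of T t n).comp (φ n)) x := fun n m h x =>
    (congrArg _ (compat n m h x)).trans (DirectLimit.NonUnitalAlgebra.of_f (R := k) h (φ n x))
  have map_one : ∀ n, DirectLimit.NonUnitalAlgebra.lift F f (DirectLimit T t)
      (fun n => (DirectLimit.NonUnitalAlgebra.of T t n).comp (φ n)) compat' 1 =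
      (⟦⟨n, φ n 1⟩⟧ : DirectLimit T t) := fun n => by
    rw [DirectLimit.one_def n]; rfl
  { φ := DirectLimit.NonUnitalAlgebra.lift F f (DirectLimit T t)
      (fun n => (DirectLimit.NonUnitalAlgebra.of T t n).comp (φ n)) compat'
    injective := by
      intro x y
      induction x, y using DirectLimit.induction₂ with | _ n x y
      intro h
      -- Equality in the limit already holds at some stage `m`, where `φ m` is injective.
      obtain ⟨m, hn, hm, h⟩ := Quotient.exact h
      change t n m hn (φ n x) = t n m hm (φ n y) at h
      rw [← compat, ← compat] at h
      exact Quotient.sound ⟨m, hn, hm, inj m h⟩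
    exists_eq := by
      intro z
      induction z using DirectLimit.induction with | _ n y
      obtain ⟨x, hx⟩ := exists_eq n y
      refine ⟨⟦⟨n, x⟩⟧, ?_⟩
      rw [map_one n, DirectLimit.mul_def, DirectLimit.mul_def, ← hx]
      rfl
    -- `FullCorner` wants its index type in `Type`, whereas `I` may live in any universe.
    ι := Fin (Fintype.card I)
    left := fun i => ⟦⟨N, l ((Fintype.equivFin I).symm i)⟩⟧
    right := fun i => ⟦⟨N, r ((Fintype.equivFin I).symm i)⟩⟧
    sum_eq_one := by
      rw [map_one N]
      simp_rw [DirectLimit.mul_def]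
      rw [Equiv.sum_comp (Fintype.equivFin I).symm (fun i =>
        (⟦⟨N, l i * φ N 1 * r i⟩⟧ : DirectLimit T t))]
      have h := congrArg (DirectLimit.Algebra.of (R := k) T t N) sum_eq
      rw [_root_.map_sum] at h
      exact h.trans (_root_.map_one (DirectLimit.Algebra.of (R := k) T t N)) }

end LimitCorner

/-! ### König's lemma for zero-labelled paths -/

section ZeroPaths

variable {G : BratteliGraph} {d : BratteliLabelling G}

/-- If no infinite path has all labels `0` for the labelling `d`, then at some level all vertices
with nonzero label for another labelling `d'` also have nonzero label for `d`. -/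
theorem BratteliLabelling.NoZeroPath.exists_level (hd : d.NoZeroPath) (d' : BratteliLabelling G) :
    ∃ n, ∀ j : G.V n, 0 < d'.size j → 0 < d.size j := by
  by_contra! hbad
  -- The level is written `0 + n` to match the paths of `NoZeroPath` starting at level `0`.
  let Bad (n : ℕ) : Type _ := {j : G.V (0 + n) // 0 < d'.size j ∧ d.size j = 0}
  have pred (n : ℕ) (j : Bad (n + 1)) : ∃ i : Bad n, 0 < G.mult i.1 j.1 := by
    obtain ⟨j, hj', hj⟩ := j
    have h := d'.size_succ (n := 0 + n) j
    have h' := d.size_succ (n := 0 + n) j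
    -- Some term of the sum for `d'` is nonzero, which provides the edge and `d' i ≠ 0`; all terms
    -- of the sum for `d` vanish, so that edge forces `d i = 0`.
    obtain ⟨i, -, hi⟩ := Finset.exists_ne_zero_of_sum_ne_zero (h.symm.trans_ne hj'.ne')
    have h0 := (Finset.sum_eq_zero_iff.1 (h'.symm.trans hj)) i (Finset.mem_univ i)
    have hm : G.mult i j ≠ 0 := left_ne_zero_of_mul hi
    exact ⟨⟨i, Nat.pos_of_ne_zero (right_ne_zero_of_mul hi),
      (Nat.mul_eq_zero.1 h0).resolve_left hm⟩, Nat.pos_of_ne_zero hm⟩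
  choose π hπ using pred
  let F : ℕᵒᵖ ⥤ Type _ := Functor.ofOpSequence (X := Bad) (fun n => TypeCat.ofHom (π n))
  have : ∀ n, Finite (F.obj n) := fun n => Subtype.finite
  have : ∀ n, Nonempty (F.obj n) := fun n => by
    obtain ⟨j, hj, hj'⟩ := hbad (0 + n.unop)
    exact ⟨⟨j, hj, Nat.le_zero.1 hj'⟩⟩
  -- A section of this inverse system of nonempty finite sets is an infinite path of bad vertices.
  obtain ⟨s, hs⟩ := nonempty_sections_of_finite_inverse_system F
  have hstep (n : ℕ) : π n (s (Opposite.op (n + 1))) = s (Opposite.op n) := by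
    have h := hs (homOfLE (Nat.le_add_right n 1)).op
    rw [Functor.ofOpSequence_map_homOfLE_succ] at h
    exact h
  obtain ⟨m, hm⟩ := hd 0 (fun m => (s (Opposite.op m)).1) fun m => by
    have h := hπ m (s (Opposite.op (m + 1)))
    rw [hstep] at h
    exact h
  exact hm.ne' (s (Opposite.op m)).2.2

end ZeroPaths

/-! ### The linking algebras and their two corners -/

section Linking

namespace Matrix

variable {k : Type*} [CommRing k]

/-- Distributing the sigma type over the sum gathers all upper left blocks together and all lower
right blocks together. -/
theorem reindex_blockDiagonal'_fromBlocks {o : Type*} [DecidableEq o] {m n : o → Type*}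
    {m' n' : Type*} (e : (Σ p, m p) ≃ m') (e' : (Σ p, n p) ≃ n')
    (x : ∀ p, Matrix (m p) (m p) k) (y : ∀ p, Matrix (n p) (n p) k) :
    reindex ((Equiv.sigmaSumDistrib m n).trans (e.sumCongr e'))
      ((Equiv.sigmaSumDistrib m n).trans (e.sumCongr e'))
      (blockDiagonal' fun p => fromBlocks (x p) 0 0 (y p)) =
    fromBlocks (reindex e e (blockDiagonal' x)) 0 0 (reindex e' e' (blockDiagonal' y)) := by
  rw [← Equiv.eq_symm_apply]
  ext ⟨p, a⟩ ⟨q, b⟩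
  by_cases h : p = q
  · subst h
    rw [blockDiagonal'_apply_eq]
    rcases a with a | a <;> rcases b with b | b <;>
      simp [Equiv.sigmaSumDistrib, blockDiagonal'_apply_eq]
  · rw [blockDiagonal'_apply_ne _ _ _ h]
    rcases a with a | a <;> rcases b with b | b <;>
      simp [Equiv.sigmaSumDistrib, blockDiagonal'_apply_ne _ _ _ h]

/-- `Matrix.blockDiagonal'`, precomposed with a map of index types, as an algebra homomorphism. -/
def blockDiagonal'AlgHom {V o : Type*} [Fintype o] [DecidableEq o] (g : o → V) (m : V → Type*)
    [∀ i, Fintype (m i)] [∀ i, DecidableEq (m i)] :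
    (∀ i, Matrix (m i) (m i) k) →ₐ[k] Matrix (Σ p, m (g p)) (Σ p, m (g p)) k where
  toFun x := blockDiagonal' fun p => x (g p)
  map_one' := blockDiagonal'_one
  map_mul' _ _ := blockDiagonal'_mul _ _
  map_zero' := blockDiagonal'_zero
  map_add' _ _ := blockDiagonal'_add _ _
  commutes' c := blockDiagonal'_diagonal fun _ _ => c

/-- The block-diagonal unit formed from two units. -/
def fromBlocksUnit {m n : Type*} [Fintype m] [DecidableEq m] [Fintype n] [DecidableEq n]
    (u : (Matrix m m k)ˣ) (v : (Matrix n n k)ˣ) : (Matrix (m ⊕ n) (m ⊕ n) k)ˣ where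
  val := fromBlocks u.val 0 0 v.val
  inv := fromBlocks u⁻¹.val 0 0 v⁻¹.val
  val_inv := by simp [fromBlocks_multiply, ← Units.val_mul, - coe_units_inv]
  inv_val := by simp [fromBlocks_multiply, ← Units.val_mul, - coe_units_inv]

/-- An element of a product of matrix algebras is full if each of its components has a diagonal
entry `1`. -/
theorem sum_single_mul_mul_single_eq_one {V : Type*} [Fintype V] [DecidableEq V] {m : V → Type*}
    [∀ i, Fintype (m i)] [∀ i, DecidableEq (m i)] (p : ∀ i, Matrix (m i) (m i) k)
    (s : ∀ i, m i → m i) (hs : ∀ i a, p i (s i a) (s i a) = 1) :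
    ∑ a : Σ i, m i, Pi.single (M := fun i => Matrix (m i) (m i) k) a.1
        (Matrix.single a.2 (s a.1 a.2) 1) * p *
      Pi.single (M := fun i => Matrix (m i) (m i) k) a.1 (Matrix.single (s a.1 a.2) a.2 1) = 1 := by
  have h (a : Σ i, m i) : Pi.single (M := fun i => Matrix (m i) (m i) k) a.1
        (Matrix.single a.2 (s a.1 a.2) 1) * p *
      Pi.single (M := fun i => Matrix (m i) (m i) k) a.1 (Matrix.single (s a.1 a.2) a.2 1) =
      Pi.single a.1 (Matrix.single a.2 a.2 1) := by
    -- Sandwiching `p` between matrix units extracts its diagonal entry at `s a`, which is `1`, and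
    -- moves it to position `a`.
    funext i
    by_cases hi : i = a.1
    · subst hi
      simp [Matrix.single_mul_mul_single, hs]
    · simp [hi]
  simp_rw [h]
  rw [Fintype.sum_sigma]
  have h' (i : V) : ∑ a : m i, Pi.single (M := fun i => Matrix (m i) (m i) k) i
      (Matrix.single a a 1) = Pi.single i 1 := by
    rw [← sum_single_one]
    exact (map_sum (AddMonoidHom.single (fun i => Matrix (m i) (m i) k) i) _ _).symm
  simp_rw [h']
  exact Finset.univ_sum_single (1 : ∀ i, Matrix (m i) (m i) k)

end Matrix

/-- Conjugation by a unit as an algebra homomorphism. -/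
def AlgHom.unitConj (k : Type*) {R : Type*} [CommRing k] [Ring R] [Algebra k R] (u : Rˣ) :
    R →ₐ[k] R where
  toFun x := u.val * x * u⁻¹.val
  map_one' := by simp
  map_mul' x y := by simp [mul_assoc]
  map_zero' := by simp
  map_add' x y := by simp [mul_add, add_mul]
  commutes' c := by simp [← Algebra.commutes c (u : R), mul_assoc]

variable {k : Type*} [Field k] {G : BratteliGraph} {d d' : BratteliLabelling G}

variable (k d d') in
/-- The linking algebra of the `n`-th stages of two labellings of the same graph. -/
abbrev BratteliLabelling.LinkingStage (n : ℕ) : Type _ :=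
  ∀ i : G.V n, Matrix (Fin (d.size i) ⊕ Fin (d'.size i)) (Fin (d.size i) ⊕ Fin (d'.size i)) k

namespace BratteliSystem

open Matrix

/-- The block-diagonal element of the linking algebra. -/
def diag {n : ℕ} (x : d.Stage k n) (y : d'.Stage k n) : d.LinkingStage k d' n :=
  fun i => fromBlocks (x i) 0 0 (y i)

/-- The same block pattern is applied to the enlarged matrices, then reindexed and conjugated by the
block sum of the two given units. -/
theorem exists_linkingMap (S : BratteliSystem k d) (S' : BratteliSystem k d') (n : ℕ) :
    ∃ τ : d.LinkingStage k d' n →ₐ[k] d.LinkingStage k d' (n + 1),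
      ∀ x y, τ (diag x y) = diag (S.map n x) (S'.map n y) := by
  choose e u h using S.map_eq n
  choose e' u' h' using S'.map_eq n
  let E (j : G.V (n + 1)) := (Equiv.sigmaSumDistrib
    (fun p : (Σ i : G.V n, Fin (G.mult i j)) => Fin (d.size p.1))
    (fun p : (Σ i : G.V n, Fin (G.mult i j)) => Fin (d'.size p.1))).trans
      ((e j).sumCongr (e' j))
  refine ⟨AlgHom.pi fun j => ((AlgHom.unitConj k (fromBlocksUnit (u j) (u' j))).comp
    (reindexAlgEquiv k k (E j)).toAlgHom).comp (blockDiagonal'AlgHom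
      (fun p : (Σ i : G.V n, Fin (G.mult i j)) => p.1)
      (fun i => Fin (d.size i) ⊕ Fin (d'.size i))), fun x y => funext fun j => ?_⟩
  have key := reindex_blockDiagonal'_fromBlocks (e j) (e' j) (fun p => x p.1) (fun p => y p.1)
  change (fromBlocksUnit (u j) (u' j)).val * reindex (E j) (E j) (blockDiagonal' fun p =>
    fromBlocks (x p.1) 0 0 (y p.1)) * (fromBlocksUnit (u j) (u' j))⁻¹.val =
      fromBlocks (S.map n x j) 0 0 (S'.map n y j)
  rw [key, h, h']
  change fromBlocks (u j).val 0 0 (u' j).val * _ *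
    fromBlocks (u j)⁻¹.val 0 0 (u' j)⁻¹.val = _
  simp only [fromBlocks_multiply, Matrix.mul_zero, Matrix.zero_mul, add_zero, zero_add]
  rfl

/-- The connecting maps of the linking algebras. -/
noncomputable def linkingMap (S : BratteliSystem k d) (S' : BratteliSystem k d') (n : ℕ) :
    d.LinkingStage k d' n →ₐ[k] d.LinkingStage k d' (n + 1) :=
  (S.exists_linkingMap S' n).choose

theorem linkingMap_diag (S : BratteliSystem k d) (S' : BratteliSystem k d') (n : ℕ)
    (x : d.Stage k n) (y : d'.Stage k n) :
    S.linkingMap S' n (diag x y) = diag (S.map n x) (S'.map n y) :=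
  (S.exists_linkingMap S' n).choose_spec x y

theorem seqTrans_linkingMap_diag (S : BratteliSystem k d) (S' : BratteliSystem k d') {n m : ℕ}
    (h : n ≤ m) (x : d.Stage k n) (y : d'.Stage k n) :
    AlgHom.seqTrans (S.linkingMap S') n m h (diag x y) =
      diag (S.trans n m h x) (S'.trans n m h y) := by
  induction m, h using Nat.le_induction with
  | base => simp [trans_self, AlgHom.seqTrans_self]
  | succ m h ih =>
    rw [trans_succ S h, trans_succ S' h, AlgHom.seqTrans_succ _ h, AlgHom.comp_apply, ih,
      linkingMap_diag]
    rfl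

/-- The limit of the linking algebras of two systems. -/
abbrev LinkingLimit (S : BratteliSystem k d) (S' : BratteliSystem k d') : Type _ :=
  DirectLimit (d.LinkingStage k d') (AlgHom.seqTrans (S.linkingMap S'))

/-- The inclusion of the upper left corner of the linking algebra. -/
def inclLeft (n : ℕ) : d.Stage k n →ₙₐ[k] d.LinkingStage k d' n where
  toFun x := diag x 0
  map_smul' c x := funext fun i => by simp [diag, fromBlocks_smul]
  map_zero' := funext fun i => fromBlocks_zero
  map_add' x y := funext fun i => by simp [diag, fromBlocks_add]
  map_mul' x y := funext fun i => by simp [diag, fromBlocks_multiply]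

/-- The inclusion of the lower right corner of the linking algebra. -/
def inclRight (n : ℕ) : d'.Stage k n →ₙₐ[k] d.LinkingStage k d' n where
  toFun y := diag 0 y
  map_smul' c x := funext fun i => by simp [diag, fromBlocks_smul]
  map_zero' := funext fun i => fromBlocks_zero
  map_add' x y := funext fun i => by simp [diag, fromBlocks_add]
  map_mul' x y := funext fun i => by simp [diag, fromBlocks_multiply]

/-- The limit of the first system as a full corner of the limit of the linking algebras. -/
noncomputable def fullCornerLeft (S : BratteliSystem k d) (S' : BratteliSystem k d') (N : ℕ)
    (hN : ∀ j : G.V N, 0 < d'.size j → 0 < d.size j) :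
    FullCorner k S.Limit (S.LinkingLimit S') :=
  FullCorner.directLimit _ _ inclLeft
    (fun n m h x => by
      change diag _ 0 = AlgHom.seqTrans (S.linkingMap S') n m h (diag x 0)
      rw [seqTrans_linkingMap_diag, map_zero])
    (fun n x y h => funext fun i => (fromBlocks_inj.1 (congrFun h i)).1)
    (fun n y => ⟨fun i => (y i).toBlocks₁₁, funext fun i => by
      change fromBlocks _ 0 0 0 = fromBlocks 1 0 0 0 * y i * fromBlocks 1 0 0 0
      conv_rhs => rw [← fromBlocks_toBlocks (y i)]
      simp [fromBlocks_multiply]⟩)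
    -- The projection has entry `1` at each upper left index. An index `b` of the lower block is
    -- sent to the upper index `0`, which exists because `b` witnesses `0 < d'.size i`, whence `0 <
    -- d.size i`.
    N _ _ (sum_single_mul_mul_single_eq_one _ (fun i a => Sum.inl (a.elim id fun b =>
        ⟨0, hN i (Nat.pos_of_ne_zero fun h => (h ▸ b).elim0)⟩)) fun i a =>
      (fromBlocks_apply₁₁ _ _ _ _ _ _).trans (one_apply_eq _))

/-- The limit of the second system as a full corner of the limit of the linking algebras. -/
noncomputable def fullCornerRight (S : BratteliSystem k d) (S' : BratteliSystem k d') (N : ℕ)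
    (hN : ∀ j : G.V N, 0 < d.size j → 0 < d'.size j) :
    FullCorner k S'.Limit (S.LinkingLimit S') :=
  FullCorner.directLimit _ _ inclRight
    (fun n m h x => by
      change diag 0 _ = AlgHom.seqTrans (S.linkingMap S') n m h (diag 0 x)
      rw [seqTrans_linkingMap_diag, map_zero])
    (fun n x y h => funext fun i => (fromBlocks_inj.1 (congrFun h i)).2.2.2)
    (fun n y => ⟨fun i => (y i).toBlocks₂₂, funext fun i => by
      change fromBlocks 0 0 0 _ = fromBlocks 0 0 0 1 * y i * fromBlocks 0 0 0 1
      conv_rhs => rw [← fromBlocks_toBlocks (y i)]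
      simp [fromBlocks_multiply]⟩)
    N _ _ (sum_single_mul_mul_single_eq_one _ (fun i a => Sum.inr (a.elim (fun b =>
        ⟨0, hN i (Nat.pos_of_ne_zero fun h => (h ▸ b).elim0)⟩) id)) fun i a =>
      (fromBlocks_apply₂₂ _ _ _ _ _ _).trans (one_apply_eq _))

end BratteliSystem

end Linking

/-- Transport of a full corner along an isomorphism. -/
def FullCorner.ofAlgEquiv {k A B R : Type*} [CommRing k] [Ring A] [Algebra k A] [Ring B]
    [Algebra k B] [Ring R] [Algebra k R] (C : FullCorner k B R) (f : A ≃ₐ[k] B) :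
    FullCorner k A R where
  φ := C.φ.comp (f : A →ₙₐ[k] B)
  injective := C.injective.comp f.injective
  exists_eq r := by
    obtain ⟨b, hb⟩ := C.exists_eq r
    refine ⟨f.symm b, ?_⟩
    change C.φ (f (f.symm b)) = C.φ (f 1) * r * C.φ (f 1)
    rw [f.apply_symm_apply, map_one f, hb]
  ι := C.ι
  left := C.left
  right := C.right
  sum_eq_one := by
    change ∑ i, C.left i * C.φ (f 1) * C.right i = 1
    rw [map_one f, C.sum_eq_one]

theorem mainTheorem12 {k : Type*} [Field k] (G : BratteliGraph)
    (d d' : BratteliLabelling G) (hd : d.NoZeroPath) (hd' : d'.NoZeroPath)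
    (A : Type*) [Ring A] [Algebra k A] (B : Type*) [Ring B] [Algebra k B]
    (hA : IsUltramatricialOf k d A) (hB : IsUltramatricialOf k d' B) :
    IsMoritaEquivalent k A B := by
  obtain ⟨S, ⟨f⟩⟩ := hA
  obtain ⟨S', ⟨f'⟩⟩ := hB
  -- The levels `N` and `N'` may differ, as each corner needs to be full at only one stage.
  obtain ⟨N, hN⟩ := hd.exists_level d'
  obtain ⟨N', hN'⟩ := hd'.exists_level d
  exact isMoritaEquivalent_of_fullCorner ((S.fullCornerLeft S' N hN).ofAlgEquiv f)
    ((S.fullCornerRight S' N' hN').ofAlgEquiv f')
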